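/- \textbf{Definitions.} All forms $[\cdot,\cdot]$ are linear in the first and conjugate linear in the second variable. A \emph{Pontryagin space of negative index} $\kappa\in\mathbb N_0$ is a complex vector space $V$ with a Hermitian form $[\cdot,\cdot]$ that admits a fundamental decomposition: $V=V_++V_-$ with $V_+\cap V_-=\{0\}$, $[v_+,v_-]=0$ for all $v_\pm\in V_\pm$, $(V_+,[\cdot,\cdot])$ and $(V_-,-[\cdot,\cdot])$ are Hilbert spaces, and $\dim V_-=\kappa$. The associated natural norm is $\|v_++v_-\|=\sqrt{[v_+,v_+]-[v_-,v_-]}$; all natural norms of $V$ are equivalent, and boundedness of operators refers to them. A Pontryagin space $\mathcal K$ of $\mathbb C^{p}$-valued functions on a set $\Omega$ has \emph{reproducing kernel} $K:\Omega\times\Omega\to\mathbb C^{p\times p}$ if for all $w\in\Omega$ and $\xi\in\mathbb C^p$ the function $K(\cdot,w)\xi$ belongs to $\mathcal K$ and $[f,K(\cdot,w)\xi]=\xi^*f(w)$ for all $f\in\mathcal K$. A function $K:\Omega\times\Omega\to\mathbb C^{p\times p}$ is a \emph{positive definite kernel} in $\Omega$ if $K(z,w)^*=K(w,z)$ for all $z,w\in\Omega$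 and, for every $M\in\mathbb N$ and $w_1,\dots,w_M\in\Omega$, the Hermitian block matrix with $(\ell,j)$ block entry $K(w_\ell,w_j)$ is nonnegative. \textbf{Theorem.} Let $(\mathcal K_1,[\cdot,\cdot]_1)$ and $(\mathcal K_2,[\cdot,\cdot]_2)$ be reproducing kernel Pontryagin spaces with the same negative index, of functions defined on a set $\Omega$ with values in $\mathbb C^{p_1}$ and $\mathbb C^{p_2}$ respectively, and with reproducing kernels $K_1$ and $K_2$. Let $m$ be a $\mathbb C^{p_2\times p_1}$-valued function on $\Omega$, let $\varphi$ be a map from $\Omega$ into itself, and assume that $$(T_{m,\varphi}f)(z)=m(z)f(\varphi(z))$$ defines a bounded operator from $\mathcal K_1$ into $\mathcal K_2$. Then $T_{m,\varphi}$ is a contraction, that is, $[T_{m,\varphi}f,T_{m,\varphi}f]_2\le[f,f]_1$ for all $f\in\mathcal K_1$, if and only if the kernel $$K_2(z,w)-m(z)K_1(\varphi(z),\varphi(w))m(w)^*$$ is positive definite in $\Omega$. -/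

import Mathlib

open scoped ComplexConjugate

noncomputable section

namespace IndefiniteKernel

/-- A sesquilinear form `[·,·]` on a complex vector space, linear in the first and conjugate
linear in the second variable: `B f g = [f, g]`. -/
abbrev SesqForm (V : Type*) [AddCommGroup V] [Module ℂ V] :=
  V →ₗ[ℂ] V →ₗ⋆[ℂ] ℂ

section Spaces

variable {V V₁ V₂ : Type*} [AddCommGroup V] [Module ℂ V]
  [AddCommGroup V₁] [Module ℂ V₁] [AddCommGroup V₂] [Module ℂ V₂]

/-- The form is Hermitian: `[g, f]` is the complex conjugate of `[f, g]`. -/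
def IsHermitianForm (B : SesqForm V) : Prop :=
  ∀ f g, conj (B f g) = B g f

/-- `V` endowed with the form `B` is a Hilbert space: `B` is a (positive definite) inner product,
and `V` is complete in its norm. Mathlib's inner products are conjugate linear in the first
variable, whence the exchange of the arguments. -/
def IsHilbertForm (B : SesqForm V) : Prop :=
  ∃ c : InnerProductSpace.Core ℂ V, (∀ f g, c.inner f g = B g f) ∧
    letI : NormedAddCommGroup V := c.toNormedAddCommGroup
    CompleteSpace V

/-- A fundamental decomposition `V = V₊ + V₋` of `(V, [·,·])`: the sum is direct and
`[·,·]`-orthogonal, and `(V₊, [·,·])` and `(V₋, -[·,·])` are Hilbert spaces. -/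
structure FundamentalDecomposition (B : SesqForm V) where
  pos : Submodule ℂ V
  neg : Submodule ℂ V
  isCompl : IsCompl pos neg
  orthogonal : ∀ v ∈ pos, ∀ w ∈ neg, B v w = 0
  hilbert_pos : IsHilbertForm (B.domRestrict₁₂ pos pos)
  hilbert_neg : IsHilbertForm (-(B.domRestrict₁₂ neg neg))

/-- The fundamental symmetry `σ (v₊ + v₋) = v₊ - v₋`. -/
def FundamentalDecomposition.symmetry {B : SesqForm V} (D : FundamentalDecomposition B) :
    V →ₗ[ℂ] V :=
  D.pos.projection D.neg D.isCompl - D.neg.projection D.pos D.isCompl.symm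

/-- The natural norm of a fundamental decomposition, that is, the norm of the Hilbert space
inner product `⟨v, w⟩ = [v, σ w] = [v₊, w₊] - [v₋, w₋]`. -/
def FundamentalDecomposition.naturalNorm {B : SesqForm V} (D : FundamentalDecomposition B)
    (v : V) : ℝ :=
  √(B v (D.symmetry v)).re

/-- `(V, [·,·])` is a Pontryagin space of negative index `κ`: a Krein space, that is, a space with
a Hermitian form that has a fundamental decomposition, with `V₋` of finite dimension `κ`. -/
def IsPontryaginSpace (B : SesqForm V) (κ : ℕ) : Prop :=
  IsHermitianForm B ∧
    ∃ D : FundamentalDecomposition B, FiniteDimensional ℂ D.neg ∧ Module.finrank ℂ D.neg = κ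

/-- The everywhere defined operator `T` is bounded with respect to natural norms of the two spaces.
All natural norms of a Krein space are equivalent, so the choice of the fundamental decompositions
does not matter. -/
def IsBoundedOperator (B₁ : SesqForm V₁) (B₂ : SesqForm V₂) (T : V₁ →ₗ[ℂ] V₂) : Prop :=
  ∃ (D₁ : FundamentalDecomposition B₁) (D₂ : FundamentalDecomposition B₂) (C : ℝ),
    ∀ f, D₂.naturalNorm (T f) ≤ C * D₁.naturalNorm f

/-- `T` is a contraction: `[T f, T f]₂ ≤ [f, f]₁` for all `f`. Both sides are real when the forms
are Hermitian. -/
def IsContraction (B₁ : SesqForm V₁) (B₂ : SesqForm V₂) (T : V₁ →ₗ[ℂ] V₂) : Prop :=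
  ∀ f, (B₂ (T f) (T f)).re ≤ (B₁ f f).re

end Spaces

section Kernels

variable {Ω : Type*} {p p₁ p₂ : ℕ}

/-- A matrix-valued kernel is positive definite on `Ω`: it is Hermitian, and for every choice of
points `w₁, …, w_M` the Hermitian block matrix with blocks `K (w_ℓ) (w_j)` is nonnegative. -/
def IsPositiveDefiniteKernel (K : Ω → Ω → Matrix (Fin p) (Fin p) ℂ) : Prop :=
  (∀ z w, (K z w).conjTranspose = K w z) ∧
    open scoped ComplexOrder in
    ∀ (M : ℕ) (w : Fin M → Ω),
      (Matrix.of fun a b : Fin M × Fin p => K (w a.1) (w b.1) a.2 b.2).PosSemidef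

/-- `K` is the reproducing kernel of the space `𝒦` of `ℂ^p`-valued functions on `Ω` with the form
`B`: each `K(·, w) ξ` is in `𝒦`, and `[f, K(·, w) ξ] = ξ* f(w)` for all `f ∈ 𝒦`. -/
structure IsReproducingKernel (𝒦 : Submodule ℂ (Ω → Fin p → ℂ)) (B : SesqForm 𝒦)
    (K : Ω → Ω → Matrix (Fin p) (Fin p) ℂ) : Prop where
  mem : ∀ (w : Ω) (ξ : Fin p → ℂ), (fun z => (K z w).mulVec ξ) ∈ 𝒦
  reproducing : ∀ (f : 𝒦) (w : Ω) (ξ : Fin p → ℂ),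
    B f ⟨fun z => (K z w).mulVec ξ, mem w ξ⟩ = dotProduct (star ξ) ((f : Ω → Fin p → ℂ) w)

/-- `(T_{m,φ} f)(z) = m(z) f(φ(z))` as a linear map on all functions. -/
def weightedComposition (m : Ω → Matrix (Fin p₂) (Fin p₁) ℂ) (φ : Ω → Ω) :
    (Ω → Fin p₁ → ℂ) →ₗ[ℂ] (Ω → Fin p₂ → ℂ) where
  toFun f z := (m z).mulVec (f (φ z))
  map_add' f g := by
    funext z
    simp [Matrix.mulVec_add]
  map_smul' c f := by
    funext z
    simp [Matrix.mulVec_smul]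

end Kernels

end IndefiniteKernel

end

open scoped ComplexConjugate InnerProductSpace

namespace IndefiniteKernel

/-! ### Negative subspaces and adjoints of contractions, with finite negative index. -/

section Algebra

variable {V V₁ V₂ : Type*} [AddCommGroup V] [Module ℂ V]
  [AddCommGroup V₁] [Module ℂ V₁] [AddCommGroup V₂] [Module ℂ V₂]

/-! The adjoint `S` of `T` sends `K₂(·, w) ξ` to `K₁(·, φ w) (m w)ᴴ ξ` (`adjoint_kernelSection`).
Hence on finite sums `g` of kernel functions the defect `[g, g]₂ - [S g, S g]₁` is the quadratic
form of the difference kernel (`defect_sum_kernelSection`). These sums are dense and `S` is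
continuous for natural norms, so the kernel is positive definite exactly when `S` is a contraction.

It remains to pass between `T` and `S`. In Pontryagin spaces this needs the equality of the negative
indices (`IsContraction.adjoint`): a contraction carries a maximal negative subspace injectively
onto a negative subspace of the same dimension, which is again maximal, so that its orthogonal
complement is nonnegative. Applied to `T` and to `S`, this gives the two implications. -/

theorem IsHilbertForm.re_nonneg {B : SesqForm V} (hB : IsHilbertForm B) (v : V) :
    0 ≤ (B v v).re := by
  obtain ⟨c, hc, -⟩ := hB
  rw [← hc]
  exact c.re_inner_nonneg v

theorem IsHilbertForm.eq_zero_of_re_nonpos {B : SesqForm V} (hB : IsHilbertForm B) {v : V}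
    (hv : (B v v).re ≤ 0) : v = 0 := by
  have h0 := hB.re_nonneg v
  obtain ⟨c, hc, -⟩ := hB
  refine c.definite v ?_
  have him : (c.inner v v).im = 0 := Complex.conj_eq_iff_im.1 (c.conj_inner_symm v v)
  rw [hc] at him ⊢
  exact Complex.ext (le_antisymm hv h0) him

theorem IsHermitianForm.im_self {B : SesqForm V} (hB : IsHermitianForm B) (v : V) :
    (B v v).im = 0 :=
  Complex.conj_eq_iff_im.1 (hB v v)

theorem IsHermitianForm.re_add {B : SesqForm V} (hB : IsHermitianForm B) (v w : V) :
    (B (v + w) (v + w)).re = (B v v).re + (B w w).re + 2 * (B v w).re := by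
  have : (B w v).re = (B v w).re := by rw [← hB v w, Complex.conj_re]
  simp only [map_add, LinearMap.add_apply, Complex.add_re, this]
  ring

namespace FundamentalDecomposition

variable {B : SesqForm V} (D : FundamentalDecomposition B)

theorem re_nonneg_of_mem_pos {v : V} (hv : v ∈ D.pos) : 0 ≤ (B v v).re :=
  D.hilbert_pos.re_nonneg ⟨v, hv⟩

theorem re_nonpos_of_mem_neg {v : V} (hv : v ∈ D.neg) : (B v v).re ≤ 0 := by
  have h : 0 ≤ (-(B v v)).re := D.hilbert_neg.re_nonneg ⟨v, hv⟩
  rwa [Complex.neg_re, Left.nonneg_neg_iff] at h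

theorem eq_zero_of_mem_neg {v : V} (hv : v ∈ D.neg) (h : 0 ≤ (B v v).re) : v = 0 := by
  have h' : (-(B v v)).re ≤ 0 := by rwa [Complex.neg_re, Left.neg_nonpos_iff]
  exact congrArg Subtype.val (D.hilbert_neg.eq_zero_of_re_nonpos (v := ⟨v, hv⟩) h')

/-- The orthogonal complement of a maximal negative subspace is nonnegative. -/
theorem re_nonneg_of_orthogonal {N : Type*} [AddCommGroup N] [Module ℂ N]
    [FiniteDimensional ℂ N] [FiniteDimensional ℂ D.neg] (hB : IsHermitianForm B)
    (A : N →ₗ[ℂ] V) (hrank : Module.finrank ℂ N = Module.finrank ℂ D.neg)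
    (hneg : ∀ n, n ≠ 0 → (B (A n) (A n)).re < 0) {u : V} (hu : ∀ n, B u (A n) = 0) :
    0 ≤ (B u u).re := by
  by_contra! hlt
  -- The source has dimension one more than `V₋`, so some nonzero `(n, c)` is mapped into `V₊`; but
  -- the form would be negative on `A n + c • u`.
  let L : N × ℂ →ₗ[ℂ] V := A.coprod (LinearMap.toSpanSingleton ℂ V u)
  have hker : LinearMap.ker ((D.neg.projectionOnto D.pos D.isCompl.symm).comp L) ≠ ⊥ :=
    LinearMap.ker_ne_bot_of_finrank_lt (by simp [hrank])
  obtain ⟨⟨n, c⟩, hmem, hne⟩ := (Submodule.ne_bot_iff _).1 hker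
  have hpos : A n + c • u ∈ D.pos := by
    have h : D.neg.projectionOnto D.pos D.isCompl.symm (A n + c • u) = 0 := by
      simpa only [L, LinearMap.mem_ker, LinearMap.comp_apply, LinearMap.coprod_apply,
        LinearMap.toSpanSingleton_apply] using hmem
    exact (Submodule.projectionOnto_apply_eq_zero_iff _).1 h
  have h0 := D.re_nonneg_of_mem_pos hpos
  have h1 : B (A n) u = 0 := by rw [← hB, hu, map_zero]
  have h2 : (B (c • u) (c • u)).re = Complex.normSq c * (B u u).re := by
    simp only [map_smul, LinearMap.smul_apply, LinearMap.map_smulₛₗ, smul_eq_mul]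
    rw [mul_left_comm, ← mul_assoc, Complex.mul_conj, Complex.re_ofReal_mul]
  have h3 : (B (A n) (c • u)).re = 0 := by simp [LinearMap.map_smulₛₗ, h1]
  rw [hB.re_add, h2, h3] at h0
  have h4 : Complex.normSq c * (B u u).re ≤ 0 :=
    mul_nonpos_of_nonneg_of_nonpos (Complex.normSq_nonneg c) hlt.le
  have hn : n = 0 := by
    by_contra hn
    linarith [hneg n hn]
  have hc : c = 0 := by
    by_contra hc
    have := mul_neg_of_pos_of_neg (Complex.normSq_pos.2 hc) hlt
    simp only [hn, map_zero, Complex.zero_re] at h0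
    linarith
  exact hne (by simp [hn, hc])

end FundamentalDecomposition

/-- The form is definite on the range of `A`, so the Gram map `E ∘ A` is injective, hence bijective
between spaces of equal finite dimension; solving it for `-E u` gives the correction. -/
theorem exists_orthogonal_of_negative {N : Type*} [AddCommGroup N] [Module ℂ N]
    [FiniteDimensional ℂ N] (B : SesqForm V) (A : N →ₗ[ℂ] V)
    (hneg : ∀ n, n ≠ 0 → (B (A n) (A n)).re < 0) (u : V) :
    ∃ n, ∀ n', B (u + A n) (A n') = 0 := by
  let b := Module.finBasis ℂ N
  let E : V →ₗ[ℂ] (Fin (Module.finrank ℂ N) → ℂ) := LinearMap.pi fun i => B.flip (A (b i))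
  have key : ∀ v, E v = 0 → ∀ n', B v (A n') = 0 := by
    intro v hv n'
    rw [← b.sum_repr n']
    simp only [map_sum, map_smul, LinearMap.map_smulₛₗ]
    exact Finset.sum_eq_zero fun i _ => by
      have : B v (A (b i)) = 0 := congrFun hv i
      rw [this, smul_zero]
  have hinj : Function.Injective (E.comp A) := by
    rw [← LinearMap.ker_eq_bot, LinearMap.ker_eq_bot']
    intro n hn
    by_contra hne
    have := hneg n hne
    rw [key (A n) hn n] at this
    simp at this
  have hsurj : Function.Surjective (E.comp A) :=
    (LinearMap.injective_iff_surjective_of_finrank_eq_finrank (by simp)).1 hinj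
  obtain ⟨n, hn⟩ := hsurj (-E u)
  refine ⟨n, key _ ?_⟩
  have hn' : E (A n) = -E u := hn
  rw [map_add, hn', add_neg_cancel]

/-- The adjoint of a contraction between Pontryagin spaces with the same negative index is a
contraction. -/
theorem IsContraction.adjoint {B₁ : SesqForm V₁} {B₂ : SesqForm V₂} (hB₁ : IsHermitianForm B₁)
    (hB₂ : IsHermitianForm B₂) (D₁ : FundamentalDecomposition B₁)
    (D₂ : FundamentalDecomposition B₂) [FiniteDimensional ℂ D₁.neg] [FiniteDimensional ℂ D₂.neg]
    (hrank : Module.finrank ℂ D₁.neg = Module.finrank ℂ D₂.neg)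
    {T : V₁ →ₗ[ℂ] V₂} {S : V₂ →ₗ[ℂ] V₁} (hTS : ∀ f g, B₂ (T f) g = B₁ f (S g))
    (hT : IsContraction B₁ B₂ T) : IsContraction B₂ B₁ S := by
  intro g
  let A : D₁.neg →ₗ[ℂ] V₂ := T.comp D₁.neg.subtype
  have hneg : ∀ n, n ≠ 0 → (B₂ (A n) (A n)).re < 0 := by
    intro n hn
    refine (hT n).trans_lt (lt_of_not_ge fun h => hn ?_)
    exact Subtype.ext (D₁.eq_zero_of_mem_neg n.2 h)
  -- With `f = n - S g`, the corrected vector is `T f + g`, where the form is nonnegative, while `f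
  -- + S g = n` is nonpositive. Both expansions have the cross term `2 Re [f, S g]₁`, which cancels
  -- on comparison.
  obtain ⟨n, hn⟩ := exists_orthogonal_of_negative B₂ A hneg (g - T (S g))
  have h0 := D₂.re_nonneg_of_orthogonal hB₂ A hrank hneg hn
  have h1 := D₁.re_nonpos_of_mem_neg n.2
  set f : V₁ := n - S g with hf
  have e1 : (n : V₁) = f + S g := by simp [hf]
  have e2 : g - T (S g) + A n = T f + g := by
    simp only [A, hf, LinearMap.comp_apply, Submodule.subtype_apply, map_sub]
    abel
  rw [e2, hB₂.re_add, hTS f g] at h0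
  rw [e1, hB₁.re_add] at h1
  have h2 := hT f
  linarith

end Algebra

/-! ### Hilbert space models: existence of the adjoint and density. -/

section Hilbert

variable {V V₁ V₂ : Type*} [AddCommGroup V] [Module ℂ V]
  [AddCommGroup V₁] [Module ℂ V₁] [AddCommGroup V₂] [Module ℂ V₂]

universe u

theorem IsHilbertForm.exists_linearEquiv {V : Type u} [AddCommGroup V] [Module ℂ V]
    {B : SesqForm V} (hB : IsHilbertForm B) :
    ∃ (H : Type u) (_ : NormedAddCommGroup H) (_ : InnerProductSpace ℂ H) (_ : CompleteSpace H)
      (e : V ≃ₗ[ℂ] H), ∀ v w, ⟪e v, e w⟫_ℂ = B w v := by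
  obtain ⟨c, hc, hcomp⟩ := hB
  exact ⟨V, c.toNormedAddCommGroup, InnerProductSpace.ofCore c.toCore, hcomp,
    LinearEquiv.refl ℂ V, hc⟩

/-- A space with a fundamental decomposition is a Hilbert space in its natural norm, and its form
is given by a symmetry. -/
theorem FundamentalDecomposition.exists_linearEquiv {V : Type u} [AddCommGroup V] [Module ℂ V]
    {B : SesqForm V} (hB : IsHermitianForm B) (D : FundamentalDecomposition B) :
    ∃ (H : Type u) (_ : NormedAddCommGroup H) (_ : InnerProductSpace ℂ H) (_ : CompleteSpace H)
      (e : V ≃ₗ[ℂ] H) (J : H →L[ℂ] H), (∀ x, J (J x) = x) ∧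
      (∀ x y, ⟪J x, y⟫_ℂ = ⟪x, J y⟫_ℂ) ∧ (∀ v w, B v w = ⟪e w, J (e v)⟫_ℂ) ∧
      ∀ v, D.naturalNorm v = ‖e v‖ := by
  obtain ⟨P, _, _, _, eP, hP⟩ := D.hilbert_pos.exists_linearEquiv
  obtain ⟨N, _, _, _, eN, hN⟩ := D.hilbert_neg.exists_linearEquiv
  let ι := WithLp.prodContinuousLinearEquiv 2 ℂ P N
  let J : WithLp 2 (P × N) →L[ℂ] WithLp 2 (P × N) :=
    ι.symm.toContinuousLinearMap ∘L
      ((ContinuousLinearMap.fst ℂ P N).prod (-ContinuousLinearMap.snd ℂ P N)) ∘L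
        ι.toContinuousLinearMap
  let e₀ := D.pos.prodEquivOfIsCompl D.neg D.isCompl
  let e : V ≃ₗ[ℂ] WithLp 2 (P × N) :=
    (e₀.symm.trans (eP.prodCongr eN)).trans ι.symm.toLinearEquiv
  have hJ : ∀ x, J x = WithLp.toLp 2 (x.fst, -x.snd) := fun x => rfl
  have hform : ∀ a b : D.pos × D.neg,
      B (e₀ a) (e₀ b) = B a.1 b.1 + B a.2 b.2 := by
    intro a b
    have h1 := D.orthogonal a.1 a.1.2 b.2 b.2.2
    have h2 : B a.2 b.1 = 0 := by
      rw [← hB, D.orthogonal b.1 b.1.2 a.2 a.2.2, map_zero]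
    simp [e₀, h1, h2]
  have hBJ : ∀ v w, B v w = ⟪e w, J (e v)⟫_ℂ := by
    intro v w
    obtain ⟨a, rfl⟩ := e₀.surjective v
    obtain ⟨b, rfl⟩ := e₀.surjective w
    have hea : e (e₀ a) = WithLp.toLp 2 (eP a.1, eN a.2) := by simp [e, ι]
    have heb : e (e₀ b) = WithLp.toLp 2 (eP b.1, eN b.2) := by simp [e, ι]
    rw [hform, hJ, hea, heb, WithLp.prod_inner_apply, inner_neg_right]
    change _ = ⟪eP b.1, eP a.1⟫_ℂ + -⟪eN b.2, eN a.2⟫_ℂ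
    rw [hP, hN]
    change _ = B a.1 b.1 + -(-B a.2 b.2)
    rw [neg_neg]
  have hsymm : ∀ v, e (D.symmetry v) = J (e v) := by
    intro v
    obtain ⟨a, rfl⟩ := e₀.surjective v
    have h1 : D.symmetry (e₀ a) = e₀ (a.1, -a.2) := by
      simp [FundamentalDecomposition.symmetry, e₀, sub_eq_add_neg]
    rw [h1]
    simp [e, ι, J]
  have hJJ : ∀ x, J (J x) = x := fun x => by simp [J]
  have hJs : ∀ x y, ⟪J x, y⟫_ℂ = ⟪x, J y⟫_ℂ := fun x y => by
    simp [WithLp.prod_inner_apply, hJ]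
  refine ⟨WithLp 2 (P × N), inferInstance, inferInstance, inferInstance, e, J, hJJ, hJs, hBJ,
    fun v => ?_⟩
  rw [FundamentalDecomposition.naturalNorm, hBJ, hsymm, hJs, hJJ, norm_eq_sqrt_re_inner (𝕜 := ℂ)]
  rfl

/-- A bounded operator has an adjoint, and the adjoint is a contraction if it is contractive on a
total subspace. -/
theorem IsBoundedOperator.exists_adjoint {B₁ : SesqForm V₁} {B₂ : SesqForm V₂}
    (hB₁ : IsHermitianForm B₁) (hB₂ : IsHermitianForm B₂) {T : V₁ →ₗ[ℂ] V₂}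
    (hT : IsBoundedOperator B₁ B₂ T) :
    ∃ S : V₂ →ₗ[ℂ] V₁, (∀ f g, B₂ (T f) g = B₁ f (S g)) ∧
      ∀ W : Submodule ℂ V₂, (∀ f, (∀ g ∈ W, B₂ f g = 0) → f = 0) →
        (∀ g ∈ W, (B₁ (S g) (S g)).re ≤ (B₂ g g).re) → IsContraction B₂ B₁ S := by
  obtain ⟨D₁, D₂, C, hC⟩ := hT
  obtain ⟨H₁, _, _, _, e₁, J₁, hJJ₁, hJs₁, hBJ₁, hn₁⟩ := D₁.exists_linearEquiv hB₁
  obtain ⟨H₂, _, _, _, e₂, J₂, hJJ₂, hJs₂, hBJ₂, hn₂⟩ := D₂.exists_linearEquiv hB₂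
  let T' : H₁ →L[ℂ] H₂ :=
    ((e₂.toLinearMap.comp T).comp e₁.symm.toLinearMap).mkContinuous C fun x => by
      have := hC (e₁.symm x)
      rwa [hn₁, hn₂, e₁.apply_symm_apply] at this
  have hT' : ∀ f, T' (e₁ f) = e₂ (T f) := fun f => by simp [T']
  -- The Hilbert space adjoint, twisted by the symmetries to fit the indefinite forms.
  let S' : H₂ →L[ℂ] H₁ := J₁ ∘L (ContinuousLinearMap.adjoint T') ∘L J₂
  let S : V₂ →ₗ[ℂ] V₁ := (e₁.symm.toLinearMap.comp S'.toLinearMap).comp e₂.toLinearMap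
  have hS : ∀ g, e₁ (S g) = S' (e₂ g) := fun g => by simp [S]
  refine ⟨S, fun f g => ?_, fun W hW hle g => ?_⟩
  · rw [hBJ₁, hBJ₂, hS, ← hT', ← hJs₁, ← hJs₂]
    simp only [S', ContinuousLinearMap.comp_apply, hJJ₁, ContinuousLinearMap.adjoint_inner_left]
  -- If `x` is Hilbert-orthogonal to the image of `W`, then `J₂ x` corresponds to a vector that is
  -- `B₂`-orthogonal to `W`, because `J₂² = 1`.
  · have hdense : (W.map e₂.toLinearMap).topologicalClosure = ⊤ := by
      rw [Submodule.topologicalClosure_eq_top_iff, Submodule.eq_bot_iff]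
      intro x hx
      have h0 : e₂.symm (J₂ x) = 0 := hW _ fun g hg => by
        rw [hBJ₂, e₂.apply_symm_apply, hJJ₂]
        exact (Submodule.mem_orthogonal _ _).1 hx _ (Submodule.mem_map_of_mem hg)
      rw [← hJJ₂ x, e₂.symm.map_eq_zero_iff.1 h0, map_zero]
    have hclosed : IsClosed {x : H₂ | (⟪S' x, J₁ (S' x)⟫_ℂ).re ≤ (⟪x, J₂ x⟫_ℂ).re} :=
      isClosed_le (by fun_prop) (by fun_prop)
    have hsub : ((W.map e₂.toLinearMap : Submodule ℂ H₂) : Set H₂) ⊆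
        {x : H₂ | (⟪S' x, J₁ (S' x)⟫_ℂ).re ≤ (⟪x, J₂ x⟫_ℂ).re} := by
      rintro _ ⟨h, hh, rfl⟩
      have := hle h hh
      rwa [hBJ₁, hBJ₂, hS] at this
    have hmem : e₂ g ∈ (W.map e₂.toLinearMap).topologicalClosure := hdense ▸ Submodule.mem_top
    have := closure_minimal hsub hclosed hmem
    rwa [hBJ₁, hBJ₂, hS]

end Hilbert

/-! ### Kernel functions and the quadratic form of the difference kernel. -/

section Kernels

open Matrix
open scoped ComplexOrder

variable {Ω : Type*} {p p₁ p₂ : ℕ}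

namespace IsReproducingKernel

variable {𝒦 : Submodule ℂ (Ω → Fin p → ℂ)} {B : SesqForm 𝒦} {K : Ω → Ω → Matrix (Fin p) (Fin p) ℂ}

/-- The element `K(·, w) ξ` of a reproducing kernel space. -/
def kernelSection (hK : IsReproducingKernel 𝒦 B K) (w : Ω) (ξ : Fin p → ℂ) : 𝒦 :=
  ⟨fun z => (K z w).mulVec ξ, hK.mem w ξ⟩

theorem apply_kernelSection (hK : IsReproducingKernel 𝒦 B K) (f : 𝒦) (w : Ω) (ξ : Fin p → ℂ) :
    B f (hK.kernelSection w ξ) = star ξ ⬝ᵥ (f : Ω → Fin p → ℂ) w :=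
  hK.reproducing f w ξ

theorem kernelSection_smul (hK : IsReproducingKernel 𝒦 B K) (w : Ω) (c : ℂ) (ξ : Fin p → ℂ) :
    hK.kernelSection w (c • ξ) = c • hK.kernelSection w ξ :=
  Subtype.ext <| funext fun z => mulVec_smul (K z w) c ξ

theorem eq_zero_of_apply_eq_zero (hK : IsReproducingKernel 𝒦 B K) {f : 𝒦}
    (hf : ∀ w ξ, B f (hK.kernelSection w ξ) = 0) : f = 0 := by
  refine Subtype.ext <| funext fun w => funext fun i => ?_
  have := hf w (Pi.single i 1)
  rw [hK.apply_kernelSection, ← Pi.single_star, star_one, single_one_dotProduct] at this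
  exact this

theorem conjTranspose_eq (hB : IsHermitianForm B) (hK : IsReproducingKernel 𝒦 B K) (z w : Ω) :
    (K z w)ᴴ = K w z := by
  ext i j
  have h := hB (hK.kernelSection w (Pi.single i 1)) (hK.kernelSection z (Pi.single j 1))
  rw [hK.apply_kernelSection, hK.apply_kernelSection, ← Pi.single_star, ← Pi.single_star,
    star_one, single_one_dotProduct, single_one_dotProduct] at h
  simpa [kernelSection] using h

end IsReproducingKernel

theorem dotProduct_block_mulVec {M : ℕ} (L : Ω → Ω → Matrix (Fin p) (Fin p) ℂ) (w : Fin M → Ω)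
    (x : Fin M × Fin p → ℂ) :
    star x ⬝ᵥ ((Matrix.of fun a b : Fin M × Fin p => L (w a.1) (w b.1) a.2 b.2) *ᵥ x) =
      ∑ i, ∑ j, star (fun a => x (i, a)) ⬝ᵥ (L (w i) (w j) *ᵥ fun a => x (j, a)) := by
  simp only [dotProduct, mulVec, Fintype.sum_prod_type, Matrix.of_apply, Pi.star_apply,
    Finset.mul_sum]
  exact Finset.sum_congr rfl fun i _ => Finset.sum_comm

theorem IsPositiveDefiniteKernel.re_sum_nonneg {L : Ω → Ω → Matrix (Fin p) (Fin p) ℂ}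
    (hL : IsPositiveDefiniteKernel L) {M : ℕ} (w : Fin M → Ω) (ξ : Fin M → Fin p → ℂ) :
    0 ≤ (∑ i, ∑ j, star (ξ i) ⬝ᵥ (L (w i) (w j) *ᵥ ξ j)).re := by
  have h := (hL.2 M w).dotProduct_mulVec_nonneg fun a => ξ a.1 a.2
  rw [dotProduct_block_mulVec] at h
  exact (Complex.le_def.1 h).1

variable {𝒦₁ : Submodule ℂ (Ω → Fin p₁ → ℂ)} {𝒦₂ : Submodule ℂ (Ω → Fin p₂ → ℂ)}
    {B₁ : SesqForm 𝒦₁} {B₂ : SesqForm 𝒦₂}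
    {K₁ : Ω → Ω → Matrix (Fin p₁) (Fin p₁) ℂ} {K₂ : Ω → Ω → Matrix (Fin p₂) (Fin p₂) ℂ}
    {m : Ω → Matrix (Fin p₂) (Fin p₁) ℂ} {φ : Ω → Ω}

/-- Pairing either side with `K₁(·, z) η` comes down to evaluating `T (K₁(·, z) η)` at `w`. -/
theorem adjoint_kernelSection (hB₁ : IsHermitianForm B₁)
    (hK₁ : IsReproducingKernel 𝒦₁ B₁ K₁) (hK₂ : IsReproducingKernel 𝒦₂ B₂ K₂)
    (hmaps : ∀ f ∈ 𝒦₁, weightedComposition m φ f ∈ 𝒦₂) {S : 𝒦₂ →ₗ[ℂ] 𝒦₁}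
    (hS : ∀ f g, B₂ ((weightedComposition m φ).restrict hmaps f) g = B₁ f (S g))
    (w : Ω) (ξ : Fin p₂ → ℂ) :
    S (hK₂.kernelSection w ξ) = hK₁.kernelSection (φ w) ((m w)ᴴ *ᵥ ξ) := by
  rw [← sub_eq_zero]
  refine hK₁.eq_zero_of_apply_eq_zero fun z η => ?_
  rw [← hB₁, map_sub, ← hS, hK₂.apply_kernelSection, hK₁.apply_kernelSection, star_mulVec,
    conjTranspose_conjTranspose, ← dotProduct_mulVec, LinearMap.coe_restrict_apply]
  simp [weightedComposition]

/-- The defect of the adjoint on the span of the kernel functions is the quadratic form of the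
difference kernel. -/
theorem defect_sum_kernelSection (hB₁ : IsHermitianForm B₁)
    (hK₁ : IsReproducingKernel 𝒦₁ B₁ K₁) (hK₂ : IsReproducingKernel 𝒦₂ B₂ K₂)
    (hmaps : ∀ f ∈ 𝒦₁, weightedComposition m φ f ∈ 𝒦₂) {S : 𝒦₂ →ₗ[ℂ] 𝒦₁}
    (hS : ∀ f g, B₂ ((weightedComposition m φ).restrict hmaps f) g = B₁ f (S g))
    {M : ℕ} (w : Fin M → Ω) (ξ : Fin M → Fin p₂ → ℂ) :
    B₂ (∑ j, hK₂.kernelSection (w j) (ξ j)) (∑ j, hK₂.kernelSection (w j) (ξ j)) -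
        B₁ (S (∑ j, hK₂.kernelSection (w j) (ξ j))) (S (∑ j, hK₂.kernelSection (w j) (ξ j))) =
      ∑ i, ∑ j, star (ξ i) ⬝ᵥ
        ((K₂ (w i) (w j) - m (w i) * K₁ (φ (w i)) (φ (w j)) * (m (w j))ᴴ) *ᵥ ξ j) := by
  simp only [map_sum, LinearMap.sum_apply, ← Finset.sum_sub_distrib]
  refine Finset.sum_congr rfl fun i _ => Finset.sum_congr rfl fun j _ => ?_
  rw [← hS, hK₂.apply_kernelSection, hK₂.apply_kernelSection, LinearMap.coe_restrict_apply,
    adjoint_kernelSection hB₁ hK₁ hK₂ hmaps hS, sub_mulVec, dotProduct_sub,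
    ← mulVec_mulVec, ← mulVec_mulVec]
  rfl

theorem isPositiveDefiniteKernel_of_contraction (hB₁ : IsHermitianForm B₁)
    (hB₂ : IsHermitianForm B₂)
    (hK₁ : IsReproducingKernel 𝒦₁ B₁ K₁) (hK₂ : IsReproducingKernel 𝒦₂ B₂ K₂)
    (hmaps : ∀ f ∈ 𝒦₁, weightedComposition m φ f ∈ 𝒦₂) {S : 𝒦₂ →ₗ[ℂ] 𝒦₁}
    (hS : ∀ f g, B₂ ((weightedComposition m φ).restrict hmaps f) g = B₁ f (S g))
    (hcontr : IsContraction B₂ B₁ S) :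
    IsPositiveDefiniteKernel (fun z w => K₂ z w - m z * K₁ (φ z) (φ w) * (m w)ᴴ) := by
  have hherm : ∀ z w, (K₂ z w - m z * K₁ (φ z) (φ w) * (m w)ᴴ)ᴴ =
      K₂ w z - m w * K₁ (φ w) (φ z) * (m z)ᴴ := by
    intro z w
    rw [conjTranspose_sub, conjTranspose_mul, conjTranspose_mul, conjTranspose_conjTranspose,
      hK₁.conjTranspose_eq hB₁, hK₂.conjTranspose_eq hB₂, Matrix.mul_assoc]
  refine ⟨hherm, fun M w => Matrix.PosSemidef.of_dotProduct_mulVec_nonneg ?_ fun x => ?_⟩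
  · ext a b
    exact congrFun (congrFun (hherm (w b.1) (w a.1)) a.2) b.2
  · rw [dotProduct_block_mulVec fun z w => K₂ z w - m z * K₁ (φ z) (φ w) * (m w)ᴴ,
      ← defect_sum_kernelSection hB₁ hK₁ hK₂ hmaps hS w fun i a => x (i, a), Complex.le_def]
    refine ⟨?_, ?_⟩
    · rw [Complex.zero_re, Complex.sub_re, sub_nonneg]
      exact hcontr _
    · rw [Complex.zero_im, Complex.sub_im, hB₁.im_self, hB₂.im_self, sub_zero]

theorem re_adjoint_le_of_isPositiveDefiniteKernel (hB₁ : IsHermitianForm B₁)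
    (hK₁ : IsReproducingKernel 𝒦₁ B₁ K₁) (hK₂ : IsReproducingKernel 𝒦₂ B₂ K₂)
    (hmaps : ∀ f ∈ 𝒦₁, weightedComposition m φ f ∈ 𝒦₂) {S : 𝒦₂ →ₗ[ℂ] 𝒦₁}
    (hS : ∀ f g, B₂ ((weightedComposition m φ).restrict hmaps f) g = B₁ f (S g))
    (hpos : IsPositiveDefiniteKernel (fun z w => K₂ z w - m z * K₁ (φ z) (φ w) * (m w)ᴴ))
    {g : 𝒦₂} (hg : g ∈ Submodule.span ℂ
      (Set.range fun q : Ω × (Fin p₂ → ℂ) => hK₂.kernelSection q.1 q.2)) :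
    (B₁ (S g) (S g)).re ≤ (B₂ g g).re := by
  obtain ⟨M, c, s, rfl⟩ := Submodule.mem_span_set'.1 hg
  choose q hq using fun j => (s j).2
  -- Scalars are absorbed into the vectors `ξ`, leaving a plain sum of kernel functions.
  have hsum : ∑ j, c j • (s j : 𝒦₂) =
      ∑ j, hK₂.kernelSection (q j).1 (c j • (q j).2) :=
    Finset.sum_congr rfl fun j _ => by rw [hK₂.kernelSection_smul, ← hq]
  rw [hsum, ← sub_nonneg, ← Complex.sub_re, defect_sum_kernelSection hB₁ hK₁ hK₂ hmaps hS]
  exact hpos.re_sum_nonneg (fun j => (q j).1) fun j => c j • (q j).2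

end Kernels

end IndefiniteKernel

theorem mainTheorem5 {Ω : Type*} {p₁ p₂ : ℕ} (κ : ℕ)
    (𝒦₁ : Submodule ℂ (Ω → Fin p₁ → ℂ)) (𝒦₂ : Submodule ℂ (Ω → Fin p₂ → ℂ))
    (B₁ : IndefiniteKernel.SesqForm 𝒦₁) (B₂ : IndefiniteKernel.SesqForm 𝒦₂)
    (hB₁ : IndefiniteKernel.IsPontryaginSpace B₁ κ)
    (hB₂ : IndefiniteKernel.IsPontryaginSpace B₂ κ)
    (K₁ : Ω → Ω → Matrix (Fin p₁) (Fin p₁) ℂ) (K₂ : Ω → Ω → Matrix (Fin p₂) (Fin p₂) ℂ)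
    (hK₁ : IndefiniteKernel.IsReproducingKernel 𝒦₁ B₁ K₁)
    (hK₂ : IndefiniteKernel.IsReproducingKernel 𝒦₂ B₂ K₂)
    (m : Ω → Matrix (Fin p₂) (Fin p₁) ℂ) (φ : Ω → Ω)
    (hmaps : ∀ f ∈ 𝒦₁, IndefiniteKernel.weightedComposition m φ f ∈ 𝒦₂)
    (hbdd : IndefiniteKernel.IsBoundedOperator B₁ B₂
      ((IndefiniteKernel.weightedComposition m φ).restrict hmaps)) :
    IndefiniteKernel.IsContraction B₁ B₂
        ((IndefiniteKernel.weightedComposition m φ).restrict hmaps) ↔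
      IndefiniteKernel.IsPositiveDefiniteKernel
        (fun z w => K₂ z w - m z * K₁ (φ z) (φ w) * (m w).conjTranspose) := by 
  obtain ⟨hH₁, D₁, hfin₁, hκ₁⟩ := hB₁
  obtain ⟨hH₂, D₂, hfin₂, hκ₂⟩ := hB₂
  obtain ⟨S, hS, htotal⟩ := hbdd.exists_adjoint hH₁ hH₂
  refine ⟨fun h => ?_, fun h => ?_⟩
  · exact IndefiniteKernel.isPositiveDefiniteKernel_of_contraction hH₁ hH₂ hK₁ hK₂ hmaps hS
      (h.adjoint hH₁ hH₂ D₁ D₂ (hκ₁.trans hκ₂.symm) hS)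
  · have hcontr : IndefiniteKernel.IsContraction B₂ B₁ S :=
      htotal (Submodule.span ℂ
        (Set.range fun q : Ω × (Fin p₂ → ℂ) => hK₂.kernelSection q.1 q.2))
        (fun f hf => hK₂.eq_zero_of_apply_eq_zero fun w ξ =>
          hf _ (Submodule.subset_span (Set.mem_range_self (w, ξ))))
        (fun g hg =>
          IndefiniteKernel.re_adjoint_le_of_isPositiveDefiniteKernel hH₁ hK₁ hK₂ hmaps hS h hg)
    -- `T` is in turn the adjoint of `S`, by Hermitian symmetry.
    refine hcontr.adjoint hH₂ hH₁ D₂ D₁ (hκ₂.trans hκ₁.symm) fun g f => ?_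
    rw [← hH₁, ← hS, hH₂]
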